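/- Let $P>0$ and let $p(y|x)$ be a memoryless channel with real input and output in an arbitrary measurable space $\mathcal Y$: given the input block $(x_1,\dots,x_N)$, the outputs $y_1,\dots,y_N$ are independent with $y_n\sim p(\cdot|x_n)$. Let $g:\mathcal Y\to\mathbb R$ be measurable, and let $\mathbf E$ denote expectation for $x\sim\mathcal N(0,P)$ and $y\sim p(\cdot|x)$. Assume $0<\mathbf E[g(y)^2]<\infty$, and put $$\Delta_g=\frac{(\mathbf E[x\,g(y)])^2}{P\,\mathbf E[g(y)^2]}\in[0,1],\qquad I_g=\frac12\log\frac1{1-\Delta_g}\quad(=\infty\text{ if }\Delta_g=1),\qquad a=\frac{\mathbf E[x\,g(y)]}{P}.$$ For a code rate $R$ (nats per channel use) and codeword length $N$, let the codebook consist of $M=\lceil e^{NR}\rceil$ mutually independent codewords $\underline x(1),\dots,\underline x(M)$, each $\mathcal N(\mathbf 0,P\mathbf I_N)$-distributed, let the message be uniformly distributed on $\{1,\dots,M\}$, and let the decoder, knowing the codebook, decide from the output block $(y_1,\dots,y_N)$ for $$\hat m\in\operatorname*{arg\,min}_{1\le m\le M}\ \sum_{n=1}^N\bigl[g(y_n)-a\,x_n(m)\bigr]^2,$$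 with ties resolved in an arbitrary way. Then the rate $I_g$ is achievable: for every $R<I_g$, the probability of decoding error, averaged over the messages and over the random codebook, tends to $0$ as $N\to\infty$. -/

import Mathlib

open MeasureTheory ProbabilityTheory Filter
open scoped ENNReal NNReal Topology

noncomputable section

namespace NearestNeighborCoding

variable {Y : Type*} [MeasurableSpace Y]

/-- Number of messages `M = ⌈e^{NR}⌉` at codeword length `N` and code rate `R` (nats per channel
use). -/
def numMessages (R : ℝ) (N : ℕ) : ℕ := ⌈Real.exp (N * R)⌉₊

/-- The i.i.d. Gaussian ensemble: the law of `M` mutually independent codewords `c m`, each with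
law `N(0, P I_N)`. -/
def codebookLaw (P : ℝ≥0) (M N : ℕ) : Measure (Fin M → Fin N → ℝ) :=
  Measure.pi fun _ => Measure.pi fun _ => gaussianReal 0 P

/-- The memoryless channel: the conditional law of the output block given the input block `x`,
where `W x` is the single-letter conditional law `p(· | x)`. -/
def outputLaw (W : Kernel ℝ Y) {N : ℕ} (x : Fin N → ℝ) : Measure (Fin N → Y) :=
  Measure.pi fun n => W (x n)

/-- The metric `D = ∑ₙ (g(yₙ) - a xₙ)²` of a codeword `x` for the output block `y`. -/
def metric (g : Y → ℝ) (a : ℝ) {N : ℕ} (x : Fin N → ℝ) (y : Fin N → Y) : ℝ :=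
  ∑ n, (g (y n) - a * x n) ^ 2

/-- `dec` is a nearest neighbor decoding rule: for every codebook and every output block it
returns a message of minimal metric (ties are resolved in an arbitrary way). -/
def IsNearestNeighbor (g : Y → ℝ) (a : ℝ) {M N : ℕ}
    (dec : (Fin M → Fin N → ℝ) → (Fin N → Y) → Fin M) : Prop :=
  ∀ (c : Fin M → Fin N → ℝ) (y : Fin N → Y) (m : Fin M),
    metric g a (c (dec c y)) y ≤ metric g a (c m) y

/-- Probability of decoding error, averaged over the uniformly distributed message and over the
i.i.d. Gaussian ensemble of codebooks. -/
def avgErrorProb (P : ℝ≥0) (W : Kernel ℝ Y) {M N : ℕ}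
    (dec : (Fin M → Fin N → ℝ) → (Fin N → Y) → Fin M) : ℝ≥0∞ :=
  ∫⁻ c, (M : ℝ≥0∞)⁻¹ * ∑ m, outputLaw W (c m) {y | dec c y ≠ m} ∂codebookLaw P M N

/-- The rate `I` (nats per channel use, possibly infinite) is achievable with the i.i.d. Gaussian
ensemble of power `P` and nearest neighbor decoding with processing function `g` and scaling
parameter `a`: at every code rate `R < I`, the average probability of error vanishes as the
codeword length grows, however ties are resolved. -/
def IsAchievable (P : ℝ≥0) (W : Kernel ℝ Y) (g : Y → ℝ) (a : ℝ) (I : EReal) : Prop :=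
  ∀ R : ℝ, (R : EReal) < I →
    ∀ dec : (N : ℕ) → (Fin (numMessages R N) → Fin N → ℝ) → (Fin N → Y) → Fin (numMessages R N),
      (∀ N, IsNearestNeighbor g a (dec N)) →
        Tendsto (fun N => avgErrorProb P W (dec N)) atTop (𝓝 0)

/-- The joint law `p(x, y)` of channel input and output, with input law `N(0, P)`. -/
def jointLaw (P : ℝ≥0) (W : Kernel ℝ Y) : Measure (ℝ × Y) := gaussianReal 0 P ⊗ₘ W

/-- `E[x g(y)]`. -/
def crossMoment (P : ℝ≥0) (W : Kernel ℝ Y) (g : Y → ℝ) : ℝ :=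
  ∫ z, z.1 * g z.2 ∂jointLaw P W

/-- `E[g(y)²]`. -/
def secondMoment (P : ℝ≥0) (W : Kernel ℝ Y) (g : Y → ℝ) : ℝ :=
  ∫ z, g z.2 ^ 2 ∂jointLaw P W

/-- `Δ_g = (E[x g(y)])² / (P E[g(y)²])`. -/
def Delta (P : ℝ≥0) (W : Kernel ℝ Y) (g : Y → ℝ) : ℝ :=
  crossMoment P W g ^ 2 / (P * secondMoment P W g)

/-- `½ log (1 / (1 - Δ_g))`, with the value `∞` for `Δ_g = 1`. -/
def gmi (P : ℝ≥0) (W : Kernel ℝ Y) (g : Y → ℝ) : EReal :=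
  if Delta P W g = 1 then ⊤
  else ((1 / 2 * Real.log (1 / (1 - Delta P W g)) : ℝ) : EReal)

end NearestNeighborCoding

end

/-! Write `G = E[g(y)²]` and `q = a² P`, so that `Δ_g = q / G`. A competing codeword is independent
of the transmitted word `x` and the output `y`. Given `(x, y)`, a Chernoff bound with parameter `θ ≥
0` and a Gaussian integral bound the probability that it wins or ties by `exp (∑ chernoffScore)`
(`pi_gaussianReal_metric_le`).

The pairs `(xₙ, yₙ)` are i.i.d., and the score has mean `θ (G - q) - ½ log (1 + 2θq) - θG / (1 +
2θq)`. Minimizing over `θ` gives `-I_g` if `q < G`, and arbitrarily negative values if `q = G`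
(`exists_chernoff_parameter`). Hence for `R < I_g` some `t < -R` exceeds the mean.

Since `g(y)` is only square integrable, the score sum is truncated at `N t`: larger sums have
vanishing probability by the law of large numbers (`tendsto_pi_sum_gt`). Otherwise a union bound
over fewer than `e^{NR}` competitors costs at most `e^{N(R + t)} → 0` (`avgErrorProb_le`). -/

namespace NearestNeighborCoding

variable {Y : Type*} [MeasurableSpace Y]

/-! ### Gaussian exponential moments and product integrals -/

/-- The exponential moment of the squared distance from a point to a scaled centred Gaussian
variable. -/
lemma lintegral_exp_neg_sq_gaussianReal {P : ℝ≥0} (hP : 0 < P) {θ : ℝ} (hθ : 0 ≤ θ) (a b : ℝ) :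
    ∫⁻ x, ENNReal.ofReal (Real.exp (-(θ * (b - a * x) ^ 2))) ∂gaussianReal 0 P
      = ENNReal.ofReal (Real.exp (-(1 / 2 * Real.log (1 + 2 * θ * a ^ 2 * P))
          - θ * b ^ 2 / (1 + 2 * θ * a ^ 2 * P))) := by
  have hP' : (0 : ℝ) < P := hP
  obtain ⟨L, hL⟩ : ∃ L : ℝ≥0, (L : ℝ) = 1 + 2 * θ * a ^ 2 * P :=
    ⟨⟨1 + 2 * θ * a ^ 2 * P, by positivity⟩, rfl⟩
  have hL0 : (0 : ℝ) < L := by rw [hL]; positivity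
  rw [← hL, gaussianReal_of_var_ne_zero _ hP.ne', lintegral_withDensity_eq_lintegral_mul _
    (measurable_gaussianPDF 0 P) (by fun_prop)]
  have hv : P / L ≠ 0 := by
    have : (0 : ℝ≥0) < L := hL0
    positivity
  -- Completing the square: tilting the density of `N(0, P)` gives a constant times the density of
  -- `N(2θabP / L, P / L)`.
  have key : ∀ x : ℝ, (gaussianPDF 0 P *
      fun x => ENNReal.ofReal (Real.exp (-(θ * (b - a * x) ^ 2)))) x
      = ENNReal.ofReal (Real.exp (-(1 / 2 * Real.log L) - θ * b ^ 2 / L))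
        * gaussianPDF (2 * θ * a * b * P / L) (P / L) x := by
    intro x
    simp only [Pi.mul_apply, gaussianPDF, gaussianPDFReal]
    rw [← ENNReal.ofReal_mul (by positivity), ← ENNReal.ofReal_mul (by positivity)]
    congr 1
    have hsq : Real.exp (-(1 / 2 * Real.log L)) = (√(L : ℝ))⁻¹ := by
      rw [Real.exp_neg, mul_comm, ← div_eq_mul_one_div, ← Real.log_sqrt hL0.le,
        Real.exp_log (Real.sqrt_pos.2 hL0)]
    have hsq2 : (√(2 * Real.pi * ((P / L : ℝ≥0) : ℝ)))⁻¹ = √(L : ℝ) * (√(2 * Real.pi * P))⁻¹ := by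
      rw [NNReal.coe_div, ← mul_div_assoc, Real.sqrt_div (by positivity), inv_div, div_eq_mul_inv]
    rw [hsq2, sub_eq_add_neg (-(1 / 2 * Real.log (L : ℝ))), Real.exp_add, hsq, mul_assoc,
      ← Real.exp_add]
    have hne : √(L : ℝ) ≠ 0 := (Real.sqrt_pos.2 hL0).ne'
    have hexp : -(x - 0) ^ 2 / (2 * (P : ℝ)) + -(θ * (b - a * x) ^ 2)
        = -(θ * b ^ 2 / L) + -(x - 2 * θ * a * b * P / L) ^ 2 / (2 * ((P / L : ℝ≥0) : ℝ)) := by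
      rw [NNReal.coe_div]
      field_simp
      rw [hL]
      ring
    rw [hexp, Real.exp_add]
    field_simp
  rw [lintegral_congr key, lintegral_const_mul _ (measurable_gaussianPDF _ _),
    lintegral_gaussianPDF_eq_one _ hv, mul_one]

/-- The integral of a product of functions of separate coordinates. -/
lemma lintegral_pi_prod {ι α : Type*} [Fintype ι] [MeasurableSpace α] (μ : Measure α)
    [IsProbabilityMeasure μ] (f : ι → α → ℝ≥0∞) (hf : ∀ i, Measurable (f i)) :
    ∫⁻ x, ∏ i, f i (x i) ∂Measure.pi (fun _ : ι => μ) = ∏ i, ∫⁻ x, f i x ∂μ := by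
  have h := lintegral_prod_eq_prod_lintegral_of_indepFun Finset.univ
    (fun (i : ι) (x : ι → α) => f i (x i))
    (iIndepFun_pi (μ := fun _ : ι => μ) fun i => (hf i).aemeasurable)
    (fun i => (hf i).comp (measurable_pi_apply i))
  refine h.trans ?_
  refine Finset.prod_congr rfl fun i _ => ?_
  exact (measurePreserving_eval (fun _ : ι => μ) i).lintegral_comp (hf i)

/-! ### Law of large numbers -/

/-- A form of the weak law of large numbers: the sample mean of an integrable function is unlikely
to exceed a level above its expectation. -/
lemma tendsto_pi_sum_gt {α : Type*} [MeasurableSpace α] (μ : Measure α) [IsProbabilityMeasure μ]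
    {h : α → ℝ} (hm : Measurable h) (hi : Integrable h μ) {t : ℝ} (ht : ∫ z, h z ∂μ < t) :
    Tendsto (fun N : ℕ => Measure.pi (fun _ : Fin N => μ) {z | N * t < ∑ n, h (z n)})
      atTop (𝓝 0) := by
  -- The strong law needs a single probability space for all `N`; the law on `Fin N → α` is
  -- recovered below as a projection of `Q`.
  set Q : Measure (ℕ → α) := Measure.infinitePi fun _ => μ with hQ
  have hev : ∀ i, MeasurePreserving (fun ω : ℕ → α => ω i) Q μ :=
    fun i => measurePreserving_eval_infinitePi (fun _ => μ) i
  have hind : iIndepFun (fun (i : ℕ) (ω : ℕ → α) => h (ω i)) Q :=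
    iIndepFun_infinitePi (P := fun _ : ℕ => μ) (X := fun _ => h) fun _ => hm
  have hslln := strong_law_ae_real (μ := Q) (fun i ω => h (ω i))
    ((hev 0).integrable_comp_of_integrable hi)
    (fun i j hij => hind.indepFun hij)
    (fun i => ⟨(hm.comp (measurable_pi_apply i)).aemeasurable,
      (hm.comp (measurable_pi_apply 0)).aemeasurable, by
        have h1 := fun i => Measure.map_map (μ := Q) hm (measurable_pi_apply (X := fun _ => α) i)
        have h2 := fun i => (hev i).map_eq
        simp only [Function.comp_def] at h1
        rw [← h1, ← h1]
        exact congrArg (Measure.map h) ((h2 i).trans (h2 0).symm)⟩)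
  have hmean : ∫ ω, h (ω 0) ∂Q = ∫ z, h z ∂μ := by
    rw [← (hev 0).map_eq, integral_map (measurable_pi_apply 0).aemeasurable
      (hm.aestronglyMeasurable)]
  rw [hmean] at hslln
  have hprob := tendstoInMeasure_of_tendsto_ae (μ := Q)
    (fun n => by
      have : Measurable fun ω : ℕ → α => (∑ i ∈ Finset.range n, h (ω i)) / n := by fun_prop
      exact this.aestronglyMeasurable) hslln
  have hlim := hprob (ENNReal.ofReal (t - ∫ z, h z ∂μ)) (by simpa using ht)
  refine tendsto_of_tendsto_of_tendsto_of_le_of_le' tendsto_const_nhds hlim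
    (Eventually.of_forall fun _ => zero_le) ?_
  filter_upwards [eventually_gt_atTop 0] with N hN
  have hmap : Q.map (fun ω (i : Fin N) => ω i) = Measure.pi (fun _ : Fin N => μ) := by
    have hI : iIndepFun (fun (i : Fin N) (ω : ℕ → α) => ω i) Q :=
      (iIndepFun_infinitePi (P := fun _ : ℕ => μ) (X := fun _ => id)
        fun _ => measurable_id).precomp (g := fun i : Fin N => (i : ℕ)) Fin.val_injective
    rw [iIndepFun.map_fun_eq_pi_map (f := fun (i : Fin N) (ω : ℕ → α) => ω i)
      (fun i => (measurable_pi_apply (i : ℕ)).aemeasurable) hI]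
    exact congrArg Measure.pi (funext fun i => (hev i).map_eq)
  rw [← hmap, Measure.map_apply (by fun_prop)
    (measurableSet_lt measurable_const (by fun_prop))]
  refine measure_mono fun ω hω => ?_
  simp only [Set.preimage_ofPred_eq, Set.mem_ofPred_eq] at hω ⊢
  rw [edist_dist, Real.dist_eq]
  refine ENNReal.ofReal_le_ofReal (le_trans ?_ (le_abs_self _))
  rw [Finset.sum_range, sub_le_sub_iff_right, le_div_iff₀ (by exact_mod_cast hN), mul_comm]
  exact hω.le

/-! ### Block channel -/

/-- The memoryless channel for blocks of length `N`, as a kernel. -/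
noncomputable def blockChannel (W : Kernel ℝ Y) [IsMarkovKernel W] (N : ℕ) :
    Kernel (Fin N → ℝ) (Fin N → Y) where
  toFun x := outputLaw W x
  measurable' := by
    have : ∀ x : Fin N → ℝ, IsProbabilityMeasure (outputLaw W x) := fun x => by
      unfold outputLaw; infer_instance
    refine Measurable.measure_of_isPiSystem_of_isProbabilityMeasure generateFrom_pi.symm
      isPiSystem_pi ?_
    rintro _ ⟨s, hs, rfl⟩
    simp only [outputLaw, Measure.pi_pi]
    refine Finset.measurable_prod _ fun i _ => ?_
    exact (W.measurable_coe (hs i (Set.mem_univ i))).comp (measurable_pi_apply i)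

lemma blockChannel_apply (W : Kernel ℝ Y) [IsMarkovKernel W] (N : ℕ) (x : Fin N → ℝ) :
    blockChannel W N x = outputLaw W x := rfl

instance (W : Kernel ℝ Y) [IsMarkovKernel W] (N : ℕ) : IsMarkovKernel (blockChannel W N) :=
  ⟨fun x => by rw [blockChannel_apply]; unfold outputLaw; infer_instance⟩

/-- The pairs of inputs and outputs of the memoryless channel with i.i.d. inputs are i.i.d. -/
lemma map_compProd_blockChannel (μ : Measure ℝ) [IsProbabilityMeasure μ] (W : Kernel ℝ Y)
    [IsMarkovKernel W] (N : ℕ) :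
    ((Measure.pi fun _ : Fin N => μ) ⊗ₘ blockChannel W N).map (fun z n => (z.1 n, z.2 n))
      = Measure.pi fun _ : Fin N => μ ⊗ₘ W := by
  refine (Measure.pi_eq fun s hs => ?_).symm
  have hzip : Measurable fun (z : (Fin N → ℝ) × (Fin N → Y)) (n : Fin N) => (z.1 n, z.2 n) := by
    fun_prop
  have hS := MeasurableSet.univ_pi hs
  rw [Measure.map_apply hzip hS, Measure.compProd_apply (hzip hS)]
  have : ∀ x : Fin N → ℝ, blockChannel W N x (Prod.mk x ⁻¹'
      ((fun (z : (Fin N → ℝ) × (Fin N → Y)) (n : Fin N) => (z.1 n, z.2 n)) ⁻¹' Set.univ.pi s))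
      = ∏ n, W (x n) (Prod.mk (x n) ⁻¹' s n) := by
    intro x
    rw [blockChannel_apply, outputLaw, ← Measure.pi_pi]
    congr 1
  rw [lintegral_congr this, lintegral_pi_prod μ (fun n x => W x (Prod.mk x ⁻¹' s n))
    fun n => Kernel.measurable_kernel_prodMk_left (hs n)]
  exact Finset.prod_congr rfl fun n _ => (Measure.compProd_apply (hs n)).symm

/-! ### Chernoff bound for one competing codeword -/

/-- The logarithm of the single-letter Chernoff bound, with parameter `θ`, on the probability that
an independent codeword is at least as close to the output as the transmitted one. -/
noncomputable def chernoffScore {Z : Type*} (P : ℝ≥0) (g : Z → ℝ) (a θ : ℝ) (z : ℝ × Z) : ℝ :=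
  θ * (g z.2 - a * z.1) ^ 2 - 1 / 2 * Real.log (1 + 2 * θ * a ^ 2 * P)
    - θ * g z.2 ^ 2 / (1 + 2 * θ * a ^ 2 * P)

lemma measurable_metric_left {Z : Type*} (g : Z → ℝ) (a : ℝ) {N : ℕ} (y : Fin N → Z) :
    Measurable fun x : Fin N → ℝ => metric g a x y := by
  unfold metric; fun_prop

lemma measurable_metric {g : Y → ℝ} (hg : Measurable g) (a : ℝ) {N : ℕ} :
    Measurable fun z : (Fin N → ℝ) × (Fin N → Y) => metric g a z.1 z.2 := by
  unfold metric; fun_prop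

lemma measurable_chernoffScore (P : ℝ≥0) {g : Y → ℝ} (hg : Measurable g) (a θ : ℝ) :
    Measurable (chernoffScore P g a θ) := by
  unfold chernoffScore; fun_prop

/-- Chernoff bound: an independent codeword is unlikely to beat the transmitted one. -/
lemma pi_gaussianReal_metric_le {P : ℝ≥0} {Z : Type*} (hP : 0 < P) (g : Z → ℝ) (a : ℝ) {θ : ℝ}
    (hθ : 0 ≤ θ) {N : ℕ} (x : Fin N → ℝ) (y : Fin N → Z) :
    Measure.pi (fun _ : Fin N => gaussianReal 0 P) {x' | metric g a x' y ≤ metric g a x y}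
      ≤ ENNReal.ofReal (Real.exp (∑ n, chernoffScore P g a θ (x n, y n))) := by
  set ν := Measure.pi (fun _ : Fin N => gaussianReal 0 P)
  set d := metric g a x y with hd
  have hset : MeasurableSet {x' : Fin N → ℝ | metric g a x' y ≤ d} :=
    measurableSet_le (measurable_metric_left g a y) measurable_const
  calc ν {x' | metric g a x' y ≤ d}
      = ∫⁻ x', Set.indicator {x' | metric g a x' y ≤ d} 1 x' ∂ν := (lintegral_indicator_one hset).symm
    _ ≤ ∫⁻ x', ENNReal.ofReal (Real.exp (θ * d)) *
          ∏ n, ENNReal.ofReal (Real.exp (-(θ * (g (y n) - a * x' n) ^ 2))) ∂ν := by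
        -- The indicator of `D(x') ≤ d` is at most `exp (θ (d - D(x')))`, which factors over
        -- coordinates.
        refine lintegral_mono (Set.indicator_le fun x' hx' => ?_)
        rw [← ENNReal.ofReal_prod_of_nonneg fun _ _ => (Real.exp_pos _).le,
          ← ENNReal.ofReal_mul (Real.exp_pos _).le, ← Real.exp_sum, ← Real.exp_add,
          Finset.sum_neg_distrib, ← Finset.mul_sum, Pi.one_apply, ENNReal.one_le_ofReal,
          Real.one_le_exp_iff]
        have : θ * metric g a x' y ≤ θ * d := mul_le_mul_of_nonneg_left hx' hθ
        unfold metric at this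
        linarith
    _ = ENNReal.ofReal (Real.exp (∑ n, chernoffScore P g a θ (x n, y n))) := by
        rw [lintegral_const_mul _ (by fun_prop), lintegral_pi_prod (gaussianReal 0 P)
          (fun n x => ENNReal.ofReal (Real.exp (-(θ * (g (y n) - a * x) ^ 2))))
          (fun n => by fun_prop)]
        simp_rw [lintegral_exp_neg_sq_gaussianReal hP hθ]
        rw [← ENNReal.ofReal_prod_of_nonneg fun _ _ => (Real.exp_pos _).le,
          ← ENNReal.ofReal_mul (Real.exp_pos _).le, ← Real.exp_sum, ← Real.exp_add, hd, metric,
          Finset.mul_sum, ← Finset.sum_add_distrib]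
        congr 2
        refine Finset.sum_congr rfl fun n _ => ?_
        unfold chernoffScore
        ring

/-! ### Random coding and the union bound -/

/-- Two distinct codewords of the ensemble are independent. -/
lemma lintegral_codebookLaw_pair (P : ℝ≥0) {M N : ℕ} {m m' : Fin M} (hm : m ≠ m')
    {F : (Fin N → ℝ) × (Fin N → ℝ) → ℝ≥0∞} (hF : Measurable F) :
    ∫⁻ c, F (c m, c m') ∂codebookLaw P M N
      = ∫⁻ x, ∫⁻ x', F (x, x') ∂(Measure.pi fun _ : Fin N => gaussianReal 0 P)
          ∂(Measure.pi fun _ : Fin N => gaussianReal 0 P) := by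
  set ν := Measure.pi fun _ : Fin N => gaussianReal 0 P
  have hev : ∀ i, (codebookLaw P M N).map (fun c => c i) = ν :=
    fun i => (measurePreserving_eval (fun _ : Fin M => ν) i).map_eq
  have hprob : IsProbabilityMeasure (codebookLaw P M N) := by unfold codebookLaw; infer_instance
  have hind : IndepFun (fun c : Fin M → Fin N → ℝ => c m) (fun c => c m') (codebookLaw P M N) :=
    (iIndepFun_pi (μ := fun _ : Fin M => ν) (X := fun _ => id)
      fun _ => measurable_id.aemeasurable).indepFun hm
  have hmap := hind.map_prod_eq_prod_map_map
    (measurable_pi_apply m).aemeasurable (measurable_pi_apply m').aemeasurable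
  rw [hev, hev] at hmap
  rw [← lintegral_prod _ hF.aemeasurable, ← hmap, lintegral_map hF (by fun_prop)]

/-- Random coding bound on the error probability of nearest neighbor decoding. -/
lemma avgErrorProb_le {P : ℝ≥0} (hP : 0 < P) (W : Kernel ℝ Y) [IsMarkovKernel W] {g : Y → ℝ}
    (hg : Measurable g) (a : ℝ) {θ : ℝ} (hθ : 0 ≤ θ) (t : ℝ) {M N : ℕ}
    {dec : (Fin M → Fin N → ℝ) → (Fin N → Y) → Fin M} (hdec : IsNearestNeighbor g a dec) :
    avgErrorProb P W dec
      ≤ Measure.pi (fun _ : Fin N => jointLaw P W) {z | N * t < ∑ n, chernoffScore P g a θ (z n)}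
        + ((M - 1 : ℕ) : ℝ≥0∞) * ENNReal.ofReal (Real.exp (N * t)) := by
  set ν := Measure.pi fun _ : Fin N => gaussianReal 0 P with hν
  set K := blockChannel W N
  set T : (Fin N → ℝ) × (Fin N → Y) → ℝ :=
    fun z => ∑ n, chernoffScore P g a θ (z.1 n, z.2 n) with hTdef
  have hT : Measurable T := by
    have := measurable_chernoffScore P hg a θ
    fun_prop
  set A : Set ((Fin N → ℝ) × (Fin N → Y)) := {z | N * t < T z} with hAdef
  have hA : MeasurableSet A := measurableSet_lt measurable_const hT
  -- Ties count as errors, which makes the bound valid for every tie-breaking rule.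
  set B : Set (((Fin N → ℝ) × (Fin N → ℝ)) × (Fin N → Y)) :=
    {z | metric g a z.1.2 z.2 ≤ metric g a z.1.1 z.2 ∧ T (z.1.1, z.2) ≤ N * t} with hBdef
  have hD := measurable_metric hg a (N := N)
  have hB : MeasurableSet B := by
    have h1 : Measurable fun z : ((Fin N → ℝ) × (Fin N → ℝ)) × (Fin N → Y) => (z.1.1, z.2) := by
      fun_prop
    have h2 : Measurable fun z : ((Fin N → ℝ) × (Fin N → ℝ)) × (Fin N → Y) => (z.1.2, z.2) := by
      fun_prop
    exact (measurableSet_le (hD.comp h2) (hD.comp h1)).inter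
      (measurableSet_le (hT.comp h1) measurable_const)
  -- the transmitted codeword has an atypically large score
  have hAint : ∀ m : Fin M, ∫⁻ c, K (c m) (Prod.mk (c m) ⁻¹' A) ∂codebookLaw P M N
      = Measure.pi (fun _ : Fin N => jointLaw P W)
          {z | N * t < ∑ n, chernoffScore P g a θ (z n)} := by
    intro m
    have h1 := (measurePreserving_eval (fun _ : Fin M => ν) m).lintegral_comp
      (Kernel.measurable_kernel_prodMk_left (κ := K) hA)
    refine h1.trans ?_
    have hscore : Measurable fun z : Fin N → ℝ × Y => ∑ n, chernoffScore P g a θ (z n) := by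
      have := measurable_chernoffScore P hg a θ
      fun_prop
    rw [← Measure.compProd_apply hA, show (fun _ : Fin N => jointLaw P W) = fun _ =>
      gaussianReal 0 P ⊗ₘ W from rfl, ← map_compProd_blockChannel, Measure.map_apply (by fun_prop)
      (measurableSet_lt measurable_const hscore)]
    rfl
  -- another codeword beats the transmitted one
  have hBint : ∀ m m' : Fin M, m ≠ m' →
      ∫⁻ c, K (c m) (Prod.mk (c m, c m') ⁻¹' B) ∂codebookLaw P M N
        ≤ ENNReal.ofReal (Real.exp (N * t)) := by
    intro m m' hm
    -- The output depends on the transmitted word only, so on pairs the channel is `K` pulled back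
    -- along the first projection.
    have hmeas : Measurable fun p : (Fin N → ℝ) × (Fin N → ℝ) => K p.1 (Prod.mk p ⁻¹' B) :=
      Kernel.measurable_kernel_prodMk_left (κ := K.comap Prod.fst measurable_fst) hB
    rw [lintegral_codebookLaw_pair P hm hmeas]
    refine (lintegral_mono (g := fun _ => ENNReal.ofReal (Real.exp (N * t))) fun x => ?_).trans
      (by simp)
    have hBx : MeasurableSet {p : (Fin N → ℝ) × (Fin N → Y) | ((x, p.1), p.2) ∈ B} :=
      hB.preimage (by fun_prop)
    -- Given `x`, the output and the competitor are independent; Tonelli lets the competitor be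
    -- averaged first, with `y` fixed.
    have h1 : ∫⁻ x', K x (Prod.mk (x, x') ⁻¹' B) ∂ν
        = ∫⁻ y, ν {x' | ((x, x'), y) ∈ B} ∂K x := by
      have e1 := Measure.prod_apply (μ := ν) (ν := K x) hBx
      have e2 := Measure.prod_apply_symm (μ := ν) (ν := K x) hBx
      exact e1.symm.trans e2
    simp only
    rw [h1]
    refine (lintegral_mono (g := fun _ => ENNReal.ofReal (Real.exp (N * t))) fun y => ?_).trans
      (by simp)
    by_cases hy : T (x, y) ≤ N * t
    · calc ν {x' | ((x, x'), y) ∈ B}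
          ≤ ν {x' | metric g a x' y ≤ metric g a x y} := measure_mono fun x' hx' => hx'.1
        _ ≤ ENNReal.ofReal (Real.exp (T (x, y))) := pi_gaussianReal_metric_le hP g a hθ x y
        _ ≤ _ := ENNReal.ofReal_le_ofReal (Real.exp_le_exp.2 hy)
    · have : {x' | ((x, x'), y) ∈ B} = ∅ :=
        Set.eq_empty_of_forall_notMem fun x' hx' => hy hx'.2
      simp [this]
  set S := Measure.pi (fun _ : Fin N => jointLaw P W)
    {z | N * t < ∑ n, chernoffScore P g a θ (z n)}
  have hmA : ∀ m : Fin M, Measurable fun c : Fin M → Fin N → ℝ => K (c m) (Prod.mk (c m) ⁻¹' A) :=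
    fun m => (Kernel.measurable_kernel_prodMk_left (κ := K) hA).comp (measurable_pi_apply m)
  have hmB : ∀ m m' : Fin M, Measurable fun c : Fin M → Fin N → ℝ =>
      K (c m) (Prod.mk (c m, c m') ⁻¹' B) := fun m m' =>
    (Kernel.measurable_kernel_prodMk_left (κ := K.comap Prod.fst measurable_fst) hB).comp
      (by fun_prop : Measurable fun c : Fin M → Fin N → ℝ => (c m, c m'))
  -- `dec` need not be measurable: monotonicity and subadditivity hold for arbitrary sets, and the
  -- bounding functions are measurable.
  have hpt : ∀ (c : Fin M → Fin N → ℝ) (m : Fin M), outputLaw W (c m) {y | dec c y ≠ m}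
      ≤ K (c m) (Prod.mk (c m) ⁻¹' A)
        + ∑ m' ∈ Finset.univ.erase m, K (c m) (Prod.mk (c m, c m') ⁻¹' B) := by
    intro c m
    have hsub : {y | dec c y ≠ m} ⊆ (Prod.mk (c m) ⁻¹' A) ∪
        ⋃ m' ∈ Finset.univ.erase m, (Prod.mk (c m, c m') ⁻¹' B) := by
      intro y hy
      by_cases hy' : N * t < T (c m, y)
      · exact Or.inl hy'
      · refine Or.inr (Set.mem_iUnion₂.2 ⟨dec c y, by simpa using hy, ?_⟩)
        exact ⟨hdec c y m, not_lt.1 hy'⟩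
    rw [← blockChannel_apply]
    refine (measure_mono hsub).trans ((measure_union_le _ _).trans ?_)
    gcongr
    exact measure_biUnion_finset_le _ _
  calc avgErrorProb P W dec
      ≤ ∫⁻ c, (M : ℝ≥0∞)⁻¹ * ∑ m, (K (c m) (Prod.mk (c m) ⁻¹' A)
        + ∑ m' ∈ Finset.univ.erase m, K (c m) (Prod.mk (c m, c m') ⁻¹' B))
          ∂codebookLaw P M N := by
        unfold avgErrorProb
        gcongr with c m _
        exact hpt c m
    _ = (M : ℝ≥0∞)⁻¹ * ∑ m : Fin M, (S + ∑ m' ∈ Finset.univ.erase m,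
          ∫⁻ c, K (c m) (Prod.mk (c m, c m') ⁻¹' B) ∂codebookLaw P M N) := by
        have hmAB : ∀ m : Fin M, Measurable fun c : Fin M → Fin N → ℝ =>
            K (c m) (Prod.mk (c m) ⁻¹' A)
              + ∑ m' ∈ Finset.univ.erase m, K (c m) (Prod.mk (c m, c m') ⁻¹' B) := fun m =>
          (hmA m).add (Finset.measurable_sum _ fun m' _ => hmB m m')
        rw [lintegral_const_mul _ (Finset.measurable_sum _ fun m _ => hmAB m),
          lintegral_finsetSum _ fun m _ => hmAB m]
        congr 1
        refine Finset.sum_congr rfl fun m _ => ?_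
        rw [lintegral_add_left (hmA m), hAint m, lintegral_finsetSum _ fun m' _ => hmB m m']
    _ ≤ (M : ℝ≥0∞)⁻¹ * ∑ m : Fin M, (S + ∑ m' ∈ Finset.univ.erase m,
          ENNReal.ofReal (Real.exp (N * t))) := by
        gcongr with m _ m' hm'
        exact hBint m m' (Finset.ne_of_mem_erase hm').symm
    _ = (M : ℝ≥0∞)⁻¹ * M * (S + ((M - 1 : ℕ) : ℝ≥0∞) * ENNReal.ofReal (Real.exp (N * t))) := by
        simp only [Finset.sum_const, Finset.card_erase_of_mem (Finset.mem_univ _),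
          Finset.card_univ, Fintype.card_fin, nsmul_eq_mul, mul_assoc]
    _ ≤ 1 * (S + ((M - 1 : ℕ) : ℝ≥0∞) * ENNReal.ofReal (Real.exp (N * t))) := by
        gcongr
        exact ENNReal.inv_mul_le_one _
    _ = _ := one_mul _

/-! ### Second moments and the mean score -/

lemma memLp_input (P : ℝ≥0) (W : Kernel ℝ Y) [IsMarkovKernel W] :
    MemLp (fun z : ℝ × Y => z.1) 2 (jointLaw P W) := by
  have hfst : MeasurePreserving (Prod.fst : ℝ × Y → ℝ) (jointLaw P W) (gaussianReal 0 P) :=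
    ⟨measurable_fst, Measure.fst_compProd _ _⟩
  exact (memLp_id_gaussianReal' 2 (by simp)).comp_measurePreserving hfst

lemma integral_input_sq (P : ℝ≥0) (W : Kernel ℝ Y) [IsMarkovKernel W] :
    ∫ z, z.1 ^ 2 ∂jointLaw P W = P := by
  have hfst : (jointLaw P W).map Prod.fst = gaussianReal 0 P := Measure.fst_compProd _ _
  have h1 : ∫ x, x ^ 2 ∂gaussianReal 0 P = P := by
    have h := variance_fun_id_gaussianReal (μ := 0) (v := P)
    rw [variance_eq_integral (by fun_prop), integral_id_gaussianReal] at h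
    simpa using h
  rw [← h1, ← hfst, integral_map measurable_fst.aemeasurable (by fun_prop)]

lemma memLp_output {P : ℝ≥0} {W : Kernel ℝ Y} {g : Y → ℝ} (hg : Measurable g)
    (hi : Integrable (fun z : ℝ × Y => g z.2 ^ 2) (jointLaw P W)) :
    MemLp (fun z : ℝ × Y => g z.2) 2 (jointLaw P W) :=
  (memLp_two_iff_integrable_sq (hg.comp measurable_snd).aestronglyMeasurable).2 hi

section Moments

variable {P : ℝ≥0} {W : Kernel ℝ Y} [IsMarkovKernel W] {g : Y → ℝ}

lemma integrable_sq_residual (hg : Measurable g)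
    (hi : Integrable (fun z : ℝ × Y => g z.2 ^ 2) (jointLaw P W)) (a : ℝ) :
    Integrable (fun z : ℝ × Y => (g z.2 - a * z.1) ^ 2) (jointLaw P W) :=
  ((memLp_output hg hi).sub ((memLp_input P W).const_mul a)).integrable_sq

/-- The mean square error of the linear estimate of `g(y)` from `x` with coefficient
`E[x g(y)] / P`. -/
lemma integral_sq_residual (hP : 0 < P) (hg : Measurable g)
    (hi : Integrable (fun z : ℝ × Y => g z.2 ^ 2) (jointLaw P W)) :
    ∫ z, (g z.2 - crossMoment P W g / P * z.1) ^ 2 ∂jointLaw P W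
      = secondMoment P W g - (crossMoment P W g / P) ^ 2 * P := by
  have hP' : (0 : ℝ) < P := hP
  set a := crossMoment P W g / P with ha
  have hC : crossMoment P W g = a * P := by rw [ha]; field_simp
  have hx := (memLp_input P W).integrable_sq
  have hxg : Integrable (fun z : ℝ × Y => z.1 * g z.2) (jointLaw P W) :=
    (memLp_input P W).integrable_mul (memLp_output hg hi)
  have hexp : ∀ z : ℝ × Y, (g z.2 - a * z.1) ^ 2
      = g z.2 ^ 2 - 2 * a * (z.1 * g z.2) + a ^ 2 * z.1 ^ 2 := fun z => by ring
  simp_rw [hexp]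
  have hsub : Integrable (fun z : ℝ × Y => g z.2 ^ 2 - 2 * a * (z.1 * g z.2)) (jointLaw P W) :=
    hi.sub (hxg.const_mul _)
  rw [integral_add hsub (hx.const_mul _), integral_sub hi (hxg.const_mul _), integral_const_mul,
    integral_const_mul, integral_input_sq]
  change secondMoment P W g - 2 * a * crossMoment P W g + a ^ 2 * P = _
  rw [hC]
  ring

lemma jointLaw_isProbabilityMeasure : IsProbabilityMeasure (jointLaw P W) := by
  unfold jointLaw; infer_instance

lemma integrable_chernoffScore (hg : Measurable g)
    (hi : Integrable (fun z : ℝ × Y => g z.2 ^ 2) (jointLaw P W)) (a θ : ℝ) :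
    Integrable (chernoffScore P g a θ) (jointLaw P W) := by
  have := jointLaw_isProbabilityMeasure (P := P) (W := W)
  exact (((integrable_sq_residual hg hi a).const_mul θ).sub (integrable_const _)).sub
    ((hi.const_mul θ).div_const _)

/-- The products are grouped so that only `G` and `q = a² P` occur, as in
`exists_chernoff_parameter`. -/
lemma integral_chernoffScore (hP : 0 < P) (hg : Measurable g)
    (hi : Integrable (fun z : ℝ × Y => g z.2 ^ 2) (jointLaw P W)) (θ : ℝ) :
    ∫ z, chernoffScore P g (crossMoment P W g / P) θ z ∂jointLaw P W
      = θ * (secondMoment P W g - (crossMoment P W g / P) ^ 2 * P)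
        - 1 / 2 * Real.log (1 + 2 * θ * ((crossMoment P W g / P) ^ 2 * P))
        - θ * secondMoment P W g / (1 + 2 * θ * ((crossMoment P W g / P) ^ 2 * P)) := by
  have := jointLaw_isProbabilityMeasure (P := P) (W := W)
  have h1 := (integrable_sq_residual hg hi (crossMoment P W g / P)).const_mul θ
  have h2 : Integrable (fun z : ℝ × Y => θ * (g z.2 - crossMoment P W g / P * z.1) ^ 2
      - 1 / 2 * Real.log (1 + 2 * θ * (crossMoment P W g / P) ^ 2 * P)) (jointLaw P W) :=
    h1.sub (integrable_const _)
  unfold chernoffScore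
  rw [integral_sub h2 ((hi.const_mul θ).div_const _),
    integral_sub h1 (integrable_const _), integral_const_mul, integral_sq_residual hP hg hi,
    integral_div, integral_const]
  simp [secondMoment, mul_assoc, integral_const_mul]

end Moments

/-! ### Choice of the Chernoff parameter and number of competitors -/

/-- Optimization of the Chernoff parameter. -/
lemma exists_chernoff_parameter {G q R : ℝ} (hG : 0 < G) (hqG : q ≤ G)
    (hR : q ≠ G → R < 1 / 2 * Real.log (1 / (1 - q / G))) :
    ∃ θ : ℝ, 0 ≤ θ ∧ θ * (G - q) - 1 / 2 * Real.log (1 + 2 * θ * q)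
      - θ * G / (1 + 2 * θ * q) < -R := by
  rcases eq_or_ne q G with rfl | hne
  -- With zero residual `G - q`, `θ` may be large: taking `1 + 2θq = exp (2|R| + 2)` makes the
  -- logarithmic term `-(|R| + 1)`.
  · have h1 : 1 < Real.exp (2 * |R| + 2) := Real.one_lt_exp_iff.2 (by positivity)
    have hL : 1 + 2 * ((Real.exp (2 * |R| + 2) - 1) / (2 * q)) * q = Real.exp (2 * |R| + 2) := by
      field_simp
      ring
    have hθ : 0 ≤ (Real.exp (2 * |R| + 2) - 1) / (2 * q) :=
      div_nonneg (by linarith) (by linarith)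
    refine ⟨_, hθ, ?_⟩
    rw [hL, Real.log_exp]
    have : 0 ≤ (Real.exp (2 * |R| + 2) - 1) / (2 * q) * q / Real.exp (2 * |R| + 2) := by
      positivity
    have := le_abs_self R
    linarith
  · have hlt : 0 < G - q := sub_pos.2 (lt_of_le_of_ne hqG hne)
    -- The stationary point `θ = 1 / (2(G - q))`: the first and last terms are both `1/2` and
    -- cancel, leaving `-I_g`.
    have hL : 1 + 2 * (1 / (2 * (G - q))) * q = 1 / (1 - q / G) := by
      have : 1 - q / G = (G - q) / G := by field_simp
      rw [this]
      field_simp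
      ring
    refine ⟨1 / (2 * (G - q)), by positivity, ?_⟩
    have h2 : 1 / (2 * (G - q)) * G / (1 / (1 - q / G)) = 1 / 2 := by
      have : 1 - q / G = (G - q) / G := by field_simp
      rw [this]
      field_simp
    have h3 : 1 / (2 * (G - q)) * (G - q) = 1 / 2 := by field_simp
    rw [hL, h2, h3]
    linarith [hR hne]

/-- Omitting the transmitted message offsets the rounding up in `⌈e^{NR}⌉`. -/
lemma numMessages_sub_one_le (R : ℝ) (N : ℕ) :
    ((numMessages R N - 1 : ℕ) : ℝ≥0∞) ≤ ENNReal.ofReal (Real.exp (N * R)) := by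
  rw [← ENNReal.ofReal_natCast]
  refine ENNReal.ofReal_le_ofReal ?_
  have hpos : 1 ≤ numMessages R N := Nat.ceil_pos.2 (Real.exp_pos _)
  rw [Nat.cast_sub hpos]
  have : (numMessages R N : ℝ) < Real.exp (N * R) + 1 := Nat.ceil_lt_add_one (Real.exp_pos _).le
  push_cast
  linarith

end NearestNeighborCoding

theorem mainTheorem3 {Y : Type*} [MeasurableSpace Y]
    (P : ℝ≥0) (hP : 0 < P)
    (W : Kernel ℝ Y) [IsMarkovKernel W]
    (g : Y → ℝ) (hg : Measurable g)
    (hg_int : Integrable (fun z : ℝ × Y => g z.2 ^ 2) (NearestNeighborCoding.jointLaw P W))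
    (hg_pos : 0 < NearestNeighborCoding.secondMoment P W g) :
    NearestNeighborCoding.IsAchievable P W g
      (NearestNeighborCoding.crossMoment P W g / P)
      (NearestNeighborCoding.gmi P W g) := by
  open NearestNeighborCoding in
  intro R hR dec hdec
  have hP' : (0 : ℝ) < P := hP
  have hprob := jointLaw_isProbabilityMeasure (P := P) (W := W)
  set a := crossMoment P W g / P with ha
  have hΔ : Delta P W g = a ^ 2 * P / secondMoment P W g := by
    rw [Delta, ha]
    field_simp
  -- The difference is the mean square residual, hence nonnegative.
  have hqG : a ^ 2 * P ≤ secondMoment P W g := by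
    rw [← sub_nonneg, ← integral_sq_residual hP hg hg_int]
    exact integral_nonneg fun z => sq_nonneg _
  obtain ⟨θ, hθ, hlt⟩ := exists_chernoff_parameter (R := R) hg_pos hqG (by
    intro hne
    rw [gmi, if_neg (by rwa [hΔ, div_eq_one_iff_eq hg_pos.ne']), EReal.coe_lt_coe_iff,
      hΔ] at hR
    exact hR)
  rw [← integral_chernoffScore hP hg hg_int θ, ← ha] at hlt
  -- `t` above the mean score serves the law of large numbers; `t < -R` makes the union bound decay.
  obtain ⟨t, hmt, htR⟩ := exists_between hlt
  have hlln := tendsto_pi_sum_gt (jointLaw P W) (measurable_chernoffScore P hg a θ)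
    (integrable_chernoffScore hg hg_int a θ) hmt
  have hexp : Tendsto (fun N : ℕ => ENNReal.ofReal (Real.exp (N * (R + t)))) atTop (𝓝 0) := by
    rw [← ENNReal.ofReal_zero]
    refine ENNReal.tendsto_ofReal (Real.tendsto_exp_atBot.comp ?_)
    exact tendsto_natCast_atTop_atTop.atTop_mul_const_of_neg (by linarith)
  have hsum := hlln.add hexp
  rw [add_zero] at hsum
  refine tendsto_of_tendsto_of_tendsto_of_le_of_le tendsto_const_nhds hsum
    (fun _ => zero_le) fun N => (avgErrorProb_le hP W hg a hθ t (hdec N)).trans ?_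
  gcongr
  rw [mul_add, Real.exp_add, ENNReal.ofReal_mul (Real.exp_pos _).le]
  gcongr
  exact numMessages_sub_one_le R N
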